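/- Let $n\ge 1$, let $\Omega\subseteq\mathbb R^n$ be open and bounded with Lipschitz boundary, let $1<p\le 1+\frac1n$ and $\frac1p+\frac1{p'}=1$. For $v\in L^p(\Omega)$ put $\mathcal G_1(v)=\int_\Omega|v|\,dx$, and let $\mathcal E_{TV}(v)=\int_{\mathbb R^n}d|Dv|=\int_\Omega d|Dv|+\int_{\partial\Omega}|v|\,d\mathcal H^{n-1}$ (with $v$ extended by zero outside $\Omega$) for $v\in BV(\Omega)$, and $\mathcal E_{TV}(v)=\infty$ for $v\in L^p(\Omega)\setminus BV(\Omega)$. Let $\mathcal E_{Per}:L^p(\Omega)\to\mathbb R$ satisfy: (E1) $\mathcal E_{Per}$ is locally Lipschitz continuous; (E2) $\mathcal E_{Per}(-v)=\mathcal E_{Per}(v)$ for all $v$; and, for some constant $C_{Per}>0$, (E3) $|\mathcal E_{Per}(v)|\le C_{Per}\|v\|_p^p$ for all $v\in L^p(\Omega)$; (E4) $\|v^*\|_{p'}\le p\,C_{Per}\|v\|_p^{p-1}$ for all $v\in L^p(\Omega)$ and all $v^*\in\partial\mathcal E_{Per}(v)\subseteq L^{p'}(\Omega)$, where $\partial$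 denotes Clarke's generalized gradient. Let $\alpha_0>0$. For $0<\alpha\le\alpha_0$ let $u_\alpha$ be a critical point, in the sense of the weak slope (of lower semicontinuous functionals on the metric space $L^p(\Omega)$), of $\mathcal E_{TV}+\mathcal E_{Per}+I_{\{\mathcal G_1=\alpha\}}$, where $I_M$ is $0$ on $M$ and $\infty$ elsewhere; in particular $\mathcal E_{TV}(u_\alpha)<\infty$ and $\mathcal G_1(u_\alpha)=\alpha$. Let $\lambda_\alpha\in\mathbb R$ be a corresponding eigenvalue, that is, a Lagrange multiplier in the Euler–Lagrange equation $$-\operatorname{Div}z+u^*=\lambda_\alpha s\quad\text{a.e. on }\Omega$$ for some $s\in L^\infty(\Omega)$ with $s(x)\in\operatorname{Sgn}(u_\alpha(x))$ for a.e. $x$ (where $\operatorname{Sgn}(t)=\{t/|t|\}$ for $t\ne0$ and $\operatorname{Sgn}(0)=[-1,1]$), some $z\in L^\infty(\Omega,\mathbb R^n)$ with $\operatorname{Div}z\in L^{p'}(\Omega)$, $\|z\|_\infty=1$ and $\mathcal E_{TV}(u_\alpha)=-\int_\Omega u_\alpha\operatorname{Div}z\,dx$, and some $u^*\in\partial\mathcal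 E_{Per}(u_\alpha)$. Assume that $$\hat c_\alpha:=\frac1\alpha\bigl(\mathcal E_{TV}(u_\alpha)+\mathcal E_{Per}(u_\alpha)\bigr)$$ is bounded for $0<\alpha\le\alpha_0$. Then there is $\alpha_1\in(0,\alpha_0]$ such that the functions $u_\alpha/\alpha$, $\alpha\in(0,\alpha_1]$, are bounded in $BV(\Omega)$. Moreover, $\hat c_\alpha$ converges (in $\mathbb R$) as $\alpha\to0^+$ if and only if $\lambda_\alpha$ converges as $\alpha\to0^+$, and in that case $\lim_{\alpha\to0}\lambda_\alpha=\lim_{\alpha\to0}\hat c_\alpha$. -/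

import Mathlib

open MeasureTheory Filter Topology Set
open scoped ENNReal NNReal

noncomputable section

namespace PerturbedOneLaplace

/-! ### Domains -/

/-- `Ω` has Lipschitz boundary: near each boundary point, `Ω` is the strict supergraph, in the
direction of some unit vector `e`, of a Lipschitz function of the coordinates orthogonal
to `e`. -/
def HasLipschitzBoundary {n : ℕ} (Ω : Set (EuclideanSpace ℝ (Fin n))) : Prop :=
  ∀ x ∈ frontier Ω, ∃ e : EuclideanSpace ℝ (Fin n), ‖e‖ = 1 ∧
    ∃ r > 0, ∃ (K : ℝ≥0) (γ : (ℝ ∙ e)ᗮ → ℝ), LipschitzWith K γ ∧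
      ∀ y ∈ Metric.ball x r,
        (y ∈ Ω ↔ γ ((ℝ ∙ e)ᗮ.orthogonalProjectionOnto y) < inner ℝ e y)

/-! ### Functions of bounded variation -/

/-- The classical divergence of a (differentiable) vector field. -/
def divergence {n : ℕ} (φ : EuclideanSpace ℝ (Fin n) → EuclideanSpace ℝ (Fin n))
    (x : EuclideanSpace ℝ (Fin n)) : ℝ :=
  ∑ i : Fin n, fderiv ℝ φ x (EuclideanSpace.single i 1) i

/-- The total variation `|Df|(U)` in the open set `U`: the supremum of `∫_U f div φ` over all
`C¹` vector fields `φ` with compact support in `U` and `|φ| ≤ 1`. -/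
def variation {n : ℕ} (f : EuclideanSpace ℝ (Fin n) → ℝ)
    (U : Set (EuclideanSpace ℝ (Fin n))) : ℝ≥0∞ :=
  ⨆ (φ : EuclideanSpace ℝ (Fin n) → EuclideanSpace ℝ (Fin n))
    (_ : ContDiff ℝ 1 φ ∧ HasCompactSupport φ ∧ tsupport φ ⊆ U ∧ ∀ x, ‖φ x‖ ≤ 1),
    ENNReal.ofReal (∫ x in U, f x * divergence φ x)

/-- The standard norm `‖f‖₁ + |Df|(Ω)` of `BV(Ω)`; it is finite exactly on `BV(Ω)`. -/
def bvNorm {n : ℕ} (Ω : Set (EuclideanSpace ℝ (Fin n)))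
    (f : EuclideanSpace ℝ (Fin n) → ℝ) : ℝ≥0∞ :=
  eLpNorm f 1 (volume.restrict Ω) + variation f Ω

/-- The functional `E_TV`: on `BV(Ω)` it is the total variation on the whole of `ℝⁿ` of the
extension by zero outside `Ω` (that is, the variation inside `Ω` together with the boundary
term `∫_{∂Ω} |f| dℋ^{n-1}`); it is `∞` outside `BV(Ω)`. -/
def energyTV {n : ℕ} (Ω : Set (EuclideanSpace ℝ (Fin n)))
    (f : EuclideanSpace ℝ (Fin n) → ℝ) : ℝ≥0∞ :=
  if bvNorm Ω f < ∞ then variation (Ω.indicator f) univ else ∞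

/-! ### Weak slope -/

/-- The weak slope of a (continuous) real function on a metric space: the supremum of the
`σ ≥ 0` for which there are `δ > 0` and a continuous deformation `η` of the ball of radius `δ`
around `u` along which the function decreases at rate at least `σ`. -/
def weakSlope {M : Type*} [MetricSpace M] (F : M → ℝ) (u : M) : ℝ≥0∞ :=
  ⨆ (σ : ℝ≥0) (_ : ∃ δ : ℝ, 0 < δ ∧ ∃ η : M × ℝ → M,
      ContinuousOn η (Metric.ball u δ ×ˢ Icc 0 δ) ∧
      ∀ v ∈ Metric.ball u δ, ∀ t ∈ Icc (0 : ℝ) δ,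
        dist (η (v, t)) v ≤ t ∧ F (η (v, t)) ≤ F v - σ * t), (σ : ℝ≥0∞)

/-- The epigraph of an extended real function, inside `X × ℝ` with the Euclidean product
metric `√(d(v₁,v₂)² + (t₁-t₂)²)`. -/
def epigraph {X : Type*} (F : X → EReal) : Set (WithLp 2 (X × ℝ)) :=
  {q | F q.fst ≤ ((q.snd : ℝ) : EReal)}

/-- The weak slope at the point `(u, F u)` of the epigraph of the projection
`epi F → ℝ`, `(v, t) ↦ t`, for `F u` finite. -/
def epigraphSlope {X : Type*} [MetricSpace X] (F : X → EReal) (u : X)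
    (hu : F u ≠ ⊤) : ℝ≥0∞ :=
  weakSlope (fun q : epigraph F => q.1.snd)
    ⟨WithLp.toLp 2 (u, (F u).toReal), EReal.le_coe_toReal hu⟩

/-- The weak slope of a (lower semicontinuous) extended real function at a point where it is
finite. -/
def lscWeakSlope {X : Type*} [MetricSpace X] (F : X → EReal) (u : X) (hu : F u ≠ ⊤) : ℝ≥0∞ :=
  if epigraphSlope F u hu < 1 then
    ENNReal.ofReal ((epigraphSlope F u hu).toReal /
      √(1 - (epigraphSlope F u hu).toReal ^ 2))
  else ∞

/-- `u` is a critical point of `F : X → ℝ ∪ {∞}` in the sense of the weak slope. -/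
def IsCriticalPoint {X : Type*} [MetricSpace X] (F : X → EReal) (u : X) : Prop :=
  ∃ hu : F u ≠ ⊤, lscWeakSlope F u hu = 0

/-! ### Clarke's generalized gradient -/

/-- Clarke's generalized directional derivative
`F⁰(u; v) = limsup_{w → u, t ↓ 0} (F (w + t v) - F w) / t`. -/
def clarkeDeriv {X : Type*} [NormedAddCommGroup X] [NormedSpace ℝ X] (F : X → ℝ)
    (u v : X) : EReal :=
  limsup (fun q : X × ℝ => (((F (q.1 + q.2 • v) - F q.1) / q.2 : ℝ) : EReal))
    (𝓝 u ×ˢ 𝓝[>] (0 : ℝ))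

/-- Clarke's generalized gradient, a subset of the dual space. -/
def clarkeGradient {X : Type*} [NormedAddCommGroup X] [NormedSpace ℝ X] (F : X → ℝ)
    (u : X) : Set (StrongDual ℝ X) :=
  {ξ | ∀ v, ((ξ v : ℝ) : EReal) ≤ clarkeDeriv F u v}

/-! ### The perturbed eigenvalue problem -/

/-- The space `L^p(Ω)`. -/
abbrev LpOn {n : ℕ} (Ω : Set (EuclideanSpace ℝ (Fin n))) (p : ℝ≥0∞) : Type :=
  Lp ℝ p (volume.restrict Ω)

section

variable {n : ℕ} {Ω : Set (EuclideanSpace ℝ (Fin n))} {p q : ℝ≥0∞}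
  [Fact (1 ≤ p)] [Fact (1 ≤ q)] [ENNReal.HolderConjugate q p]

/-- The function `w ∈ L^{p'}(Ω)`, identified with the functional `v ↦ ∫_Ω w v` on `L^p(Ω)`,
belongs to Clarke's generalized gradient of `F` at `u`. -/
def InGradient (F : LpOn Ω p → ℝ) (u : LpOn Ω p) (w : LpOn Ω q) : Prop :=
  (ContinuousLinearMap.mul ℝ ℝ).lpPairing (volume.restrict Ω) q p w ∈ clarkeGradient F u

/-- The standing conditions on the perturbation `E_Per : L^p(Ω) → ℝ` (with `q` the conjugate
exponent of `p`). -/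
def IsAdmissiblePerturbation (q : ℝ≥0∞) [Fact (1 ≤ q)] [ENNReal.HolderConjugate q p]
    (EPer : LpOn Ω p → ℝ) : Prop :=
  LocallyLipschitz EPer ∧
  (∀ v, EPer (-v) = EPer v) ∧
  ∃ C : ℝ, 0 < C ∧
    (∀ v, |EPer v| ≤ C * ‖v‖ ^ p.toReal) ∧
    (∀ (v : LpOn Ω p) (w : LpOn Ω q), InGradient EPer v w →
      ‖w‖ ≤ p.toReal * C * ‖v‖ ^ (p.toReal - 1))

/-- The constraint functional `G₁(v) = ∫_Ω |v|`. -/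
def constraintG (v : LpOn Ω p) : ℝ := ∫ x in Ω, |v x|

/-- The functional `E_TV + E_Per + I_{G₁ = α}` on `L^p(Ω)`, where the indicator function is `0`
on the constraint set and `∞` outside. -/
def constrainedEnergy (EPer : LpOn Ω p → ℝ) (α : ℝ) (v : LpOn Ω p) : EReal :=
  (energyTV Ω v : EReal) + (EPer v : EReal) + (if constraintG v = α then 0 else ⊤)

/-- The real number `E_TV(v) + E_Per(v)`, for `v` with `E_TV(v) < ∞`. -/
def energyValue (EPer : LpOn Ω p → ℝ) (v : LpOn Ω p) : ℝ :=
  (energyTV Ω v).toReal + EPer v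

/-- The set-valued sign function. -/
def Sgn (s : ℝ) : Set ℝ := if 0 < s then {1} else if s < 0 then {-1} else Icc (-1) 1

/-- `d` is the distributional divergence on `Ω` of the vector field `z`. -/
def IsWeakDivergence (Ω : Set (EuclideanSpace ℝ (Fin n)))
    (z : EuclideanSpace ℝ (Fin n) → EuclideanSpace ℝ (Fin n))
    (d : EuclideanSpace ℝ (Fin n) → ℝ) : Prop :=
  ∀ φ : EuclideanSpace ℝ (Fin n) → ℝ, ContDiff ℝ ((⊤ : ℕ∞) : WithTop ℕ∞) φ → HasCompactSupport φ → tsupport φ ⊆ Ω →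
    ∫ x in Ω, fderiv ℝ φ x (z x) = -∫ x in Ω, d x * φ x

/-- `lam` is an eigenvalue belonging to `u`, i.e. a Lagrange multiplier in the Euler-Lagrange
equation `-Div z + u* = lam s` on `Ω`, where `s ∈ L^∞(Ω)` is a selection of `Sgn(u)`,
`z ∈ L^∞(Ω, ℝⁿ)` satisfies `‖z‖_∞ = 1`, `Div z ∈ L^{p'}(Ω)` and `E_TV(u) = -∫_Ω u Div z`, and
`u* ∈ ∂E_Per(u) ⊆ L^{p'}(Ω)`. -/
def IsEigenvalue (q : ℝ≥0∞) [Fact (1 ≤ q)] [ENNReal.HolderConjugate q p]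
    (EPer : LpOn Ω p → ℝ) (u : LpOn Ω p) (lam : ℝ) : Prop :=
  ∃ (s : EuclideanSpace ℝ (Fin n) → ℝ)
    (z : EuclideanSpace ℝ (Fin n) → EuclideanSpace ℝ (Fin n))
    (divz w : LpOn Ω q),
    MemLp s ∞ (volume.restrict Ω) ∧
    (∀ᵐ x ∂(volume.restrict Ω), s x ∈ Sgn (u x)) ∧
    MemLp z ∞ (volume.restrict Ω) ∧
    eLpNorm z ∞ (volume.restrict Ω) = 1 ∧
    IsWeakDivergence Ω z divz ∧
    (energyTV Ω u : EReal) = ((-∫ x in Ω, u x * divz x : ℝ) : EReal) ∧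
    InGradient EPer u w ∧
    (∀ᵐ x ∂(volume.restrict Ω), -divz x + w x = lam * s x)

end

end PerturbedOneLaplace

end

/-! Put `T α = E_TV(u_α)/α`. Testing the Euler–Lagrange equation with `u_α` gives `λ_α = T α + α⁻¹ ∫
u* u_α`, while `ĉ_α = T α + α⁻¹ E_Per(u_α)`. By (E3), and by Hölder with (E4), both perturbation
terms are at most a constant times `α⁻¹ ‖u_α‖_p^p`.

Since `p ≤ 1 + 1/n`, this norm is controlled by mass and variation: `‖u_α‖_p^p ≤ α^p (1 + L T α)`
(`exists_norm_rpow_le`). The source is the inequality `∫ |f|^(1+1/n) ≤ C ‖f‖₁^(1/n) |Df|(ℝⁿ)`,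
applied to the zero extension (`exists_lintegral_rpow_le_variation`). It is proved for `C¹`
functions and carried over to finite variation by mollification and Fatou's lemma.

As `p > 1`, the factor `α^(p-1)` tends to zero. Boundedness of `ĉ_α` then lets the perturbation be
absorbed, so `T` is bounded for small `α`, and `ĉ_α - λ_α = O(α^(p-1))`
(`exists_bound_and_tendsto_of_growth`). -/

namespace PerturbedOneLaplace

open scoped Convolution

/-! ### A multiplicative Sobolev inequality for smooth functions -/

/-- On a one-dimensional Euclidean space, a compactly supported `C¹` function is bounded by the
integral of its derivative. -/
lemma enorm_le_lintegral_fderiv {u : EuclideanSpace ℝ (Fin 1) → ℝ} (hu : ContDiff ℝ 1 u)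
    (hc : HasCompactSupport u) (x : EuclideanSpace ℝ (Fin 1)) :
    ‖u x‖ₑ ≤ ∫⁻ y, ‖fderiv ℝ u y‖ₑ := by
  have hd : Module.finrank ℝ ℝ = Module.finrank ℝ (EuclideanSpace ℝ (Fin 1)) := by simp
  let e : ℝ ≃ₗᵢ[ℝ] EuclideanSpace ℝ (Fin 1) :=
    (stdOrthonormalBasis ℝ ℝ).equiv (stdOrthonormalBasis ℝ _) (finCongr hd)
  have he : ContDiff ℝ 1 e := e.toContinuousLinearEquiv.contDiff
  calc ‖u x‖ₑ = ‖(u ∘ e) (e.symm x)‖ₑ := by simp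
    _ ≤ ∫⁻ t in Iic (e.symm x), ‖deriv (u ∘ e) t‖ₑ :=
        HasCompactSupport.enorm_le_lintegral_Ici_deriv (hu.comp he)
          (hc.comp_isClosedEmbedding e.toHomeomorph.isClosedEmbedding) _
    _ ≤ ∫⁻ t, ‖deriv (u ∘ e) t‖ₑ := setLIntegral_le_lintegral _ _
    _ ≤ ∫⁻ t, ‖fderiv ℝ u (e t)‖ₑ := by
        refine lintegral_mono fun t => ?_
        have h1 : HasDerivAt (fun t : ℝ => e t) (e 1) t :=
          e.toContinuousLinearEquiv.toContinuousLinearMap.hasDerivAt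
        have h2 : deriv (u ∘ e) t = fderiv ℝ u (e t) (e 1) :=
          ((hu.differentiable one_ne_zero (e t)).hasFDerivAt.comp_hasDerivAt t h1).deriv
        rw [h2]
        refine (ContinuousLinearMap.le_opENorm _ _).trans ?_
        simp [e.enorm_map]
    _ = ∫⁻ y, ‖fderiv ℝ u y‖ₑ :=
        e.measurePreserving.lintegral_comp_emb e.toHomeomorph.measurableEmbedding
          (fun y => ‖fderiv ℝ u y‖ₑ)

lemma exists_lintegral_rpow_le_lintegral_fderiv {n : ℕ} (hn : 1 ≤ n) :
    ∃ C : ℝ≥0, ∀ u : EuclideanSpace ℝ (Fin n) → ℝ, ContDiff ℝ 1 u → HasCompactSupport u →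
      ∫⁻ x, ‖u x‖ₑ ^ (1 + 1 / (n : ℝ)) ≤
        C * (∫⁻ x, ‖u x‖ₑ) ^ (1 / (n : ℝ)) * ∫⁻ x, ‖fderiv ℝ u x‖ₑ := by
  -- For `n = 1` the conjugate exponent is infinite, so the sup bound replaces the Sobolev
  -- inequality.
  rcases hn.eq_or_lt with rfl | hn
  · refine ⟨1, fun u hu hc => ?_⟩
    have hm : Measurable fun x => ‖u x‖ₑ := hu.continuous.enorm.measurable
    calc ∫⁻ x, ‖u x‖ₑ ^ (1 + 1 / ((1 : ℕ) : ℝ))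
        ≤ ∫⁻ x, ‖u x‖ₑ * ∫⁻ y, ‖fderiv ℝ u y‖ₑ := by
          refine lintegral_mono fun x => ?_
          rw [ENNReal.rpow_add_of_nonneg _ _ (by norm_num) (by norm_num)]
          simp only [Nat.cast_one, ENNReal.rpow_one, div_one]
          gcongr
          exact enorm_le_lintegral_fderiv hu hc x
      _ = _ := by rw [lintegral_mul_const _ hm]; simp
  · have hn' : (1 : ℝ) < n := by exact_mod_cast hn
    have hpq : Real.HolderConjugate (n : ℝ) (Real.conjExponent n) :=
      Real.HolderConjugate.conjExponent hn'
    set m := Real.conjExponent n with hm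
    set K := lintegralPowLePowLIntegralFDerivConst
      (volume : Measure (EuclideanSpace ℝ (Fin n))) m
    refine ⟨K ^ (1 / m), fun u hu hc => ?_⟩
    have hu' : AEMeasurable fun x => ‖u x‖ₑ := hu.continuous.enorm.measurable.aemeasurable
    have hS : ∫⁻ x, ‖u x‖ₑ ^ m ≤ K * (∫⁻ x, ‖fderiv ℝ u x‖ₑ) ^ m :=
      lintegral_pow_le_pow_lintegral_fderiv volume hu hc (by simpa using hpq)
    have hm0 : 0 < m := hpq.symm.pos
    -- Hölder with exponents `n` and `m = n/(n-1)` on the product `|u|^(1/n) · |u|`; the second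
    -- factor is then the Gagliardo–Nirenberg term.
    calc ∫⁻ x, ‖u x‖ₑ ^ (1 + 1 / (n : ℝ))
        = ∫⁻ x, ((fun x => ‖u x‖ₑ ^ (1 / (n : ℝ))) * fun x => ‖u x‖ₑ) x := by
          refine lintegral_congr fun x => ?_
          rw [add_comm, ENNReal.rpow_add_of_nonneg _ _ (by positivity) zero_le_one]
          simp
      _ ≤ (∫⁻ x, (‖u x‖ₑ ^ (1 / (n : ℝ))) ^ (n : ℝ)) ^ (1 / (n : ℝ)) *
            (∫⁻ x, ‖u x‖ₑ ^ m) ^ (1 / m) :=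
          ENNReal.lintegral_mul_le_Lp_mul_Lq _ hpq (hu'.pow_const _) hu'
      _ ≤ (∫⁻ x, ‖u x‖ₑ) ^ (1 / (n : ℝ)) *
            (K * (∫⁻ x, ‖fderiv ℝ u x‖ₑ) ^ m) ^ (1 / m) := by
          gcongr with x
          rw [← ENNReal.rpow_mul, one_div_mul_cancel (by positivity), ENNReal.rpow_one]
      _ = _ := by
          rw [ENNReal.mul_rpow_of_nonneg _ _ (by positivity), ← ENNReal.rpow_mul,
            mul_one_div_cancel hm0.ne', ENNReal.rpow_one,
            ENNReal.coe_rpow_of_nonneg _ (by positivity)]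
          ring

/-! ### The variation and mollification -/

/-- The field `ψ eᵢ` is admissible in the supremum, and its divergence is `∂ᵢψ`. -/
lemma ofReal_integral_fderiv_le_variation {n : ℕ} (f : EuclideanSpace ℝ (Fin n) → ℝ) (i : Fin n)
    {ψ : EuclideanSpace ℝ (Fin n) → ℝ} (hψ : ContDiff ℝ 1 ψ) (hc : HasCompactSupport ψ)
    (hb : ∀ x, |ψ x| ≤ 1) :
    ENNReal.ofReal (∫ x, f x * fderiv ℝ ψ x (EuclideanSpace.single i 1)) ≤
      variation f univ := by
  have key : ∀ x, divergence (fun x => ψ x • EuclideanSpace.single i (1 : ℝ)) x =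
      fderiv ℝ ψ x (EuclideanSpace.single i 1) := fun x => by
    have hd := (hψ.differentiable one_ne_zero x).hasFDerivAt.smul_const
      (EuclideanSpace.single i (1 : ℝ))
    simp only [divergence, hd.fderiv]
    rw [Finset.sum_eq_single i] <;> simp +contextual
  unfold variation
  refine le_iSup₂_of_le (fun x => ψ x • EuclideanSpace.single i (1 : ℝ)) ⟨?_, ?_, ?_, ?_⟩ ?_
  · exact hψ.smul contDiff_const
  · exact hc.smul_right
  · exact subset_univ _
  · intro x
    simpa [norm_smul] using hb x
  · simp [key]

lemma fderiv_convolution_apply {n : ℕ} {f ρ : EuclideanSpace ℝ (Fin n) → ℝ}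
    (hf : LocallyIntegrable f) (hρ : ContDiff ℝ 1 ρ) (hρc : HasCompactSupport ρ)
    (x e : EuclideanSpace ℝ (Fin n)) :
    fderiv ℝ (f ⋆ ρ) x e = ∫ t, f t * fderiv ℝ ρ (x - t) e := by
  rw [(hρc.hasFDerivAt_convolution_right _ hf hρ x).fderiv,
    convolution_precompR_apply _ hf (hρc.fderiv ℝ) (hρ.continuous_fderiv one_ne_zero)]
  rfl

lemma fderiv_neg_of_even {E : Type*} [NormedAddCommGroup E] [NormedSpace ℝ E] {ρ : E → ℝ}
    (he : ∀ x, ρ (-x) = ρ x) (x : E) : fderiv ℝ ρ (-x) = -fderiv ℝ ρ x := by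
  have h2 := (ContinuousLinearEquiv.neg ℝ (M := E)).comp_right_fderiv (f := ρ) (x := x)
  have h : ρ ∘ ContinuousLinearEquiv.neg ℝ (M := E) = ρ := funext he
  rw [h] at h2
  ext v
  simp [h2]

lemma abs_convolution_le_one {n : ℕ} {ψ ρ : EuclideanSpace ℝ (Fin n) → ℝ}
    (hψ : ∀ x, |ψ x| ≤ 1) (hρ : Integrable ρ) (hρ0 : ∀ x, 0 ≤ ρ x) (hρ1 : ∫ x, ρ x = 1)
    (x : EuclideanSpace ℝ (Fin n)) : |(ψ ⋆ ρ) x| ≤ 1 := by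
  calc |(ψ ⋆ ρ) x| ≤ ∫ t, ρ (x - t) := by
        rw [convolution_def, ← Real.norm_eq_abs]
        refine norm_integral_le_of_norm_le (hρ.comp_sub_left x) (.of_forall fun t => ?_)
        simp only [ContinuousLinearMap.lsmul_apply, smul_eq_mul, norm_mul, Real.norm_eq_abs,
          abs_of_nonneg (hρ0 _)]
        exact mul_le_of_le_one_left (hρ0 _) (hψ t)
    _ = 1 := by rw [integral_sub_left_eq_self ρ volume x, hρ1]

/-- Mollification does not increase the `L¹` norm of a partial derivative beyond the variation. -/
lemma lintegral_fderiv_convolution_le_variation {n : ℕ} {f ρ : EuclideanSpace ℝ (Fin n) → ℝ}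
    (hf : Integrable f) (hfc : HasCompactSupport f) (hρ : ContDiff ℝ 1 ρ)
    (hρc : HasCompactSupport ρ) (he : ∀ x, ρ (-x) = ρ x) (hρ0 : ∀ x, 0 ≤ ρ x)
    (hρ1 : ∫ x, ρ x = 1) (i : Fin n) :
    ∫⁻ x, ‖fderiv ℝ (f ⋆ ρ) x (EuclideanSpace.single i 1)‖ₑ ≤ variation f univ := by
  set e : EuclideanSpace ℝ (Fin n) := EuclideanSpace.single i 1
  set h := fun x => fderiv ℝ (f ⋆ ρ) x e with hh
  have hg : ContDiff ℝ 1 (f ⋆ ρ) :=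
    hρc.contDiff_convolution_right (n := 1) _ hf.locallyIntegrable hρ
  have hgc : HasCompactSupport (f ⋆ ρ) := hfc.convolution _ hρc
  have hcont : Continuous h := (hg.continuous_fderiv one_ne_zero).clm_apply continuous_const
  have hhc : HasCompactSupport h := hgc.fderiv_apply ℝ e
  have hρe : Integrable fun x => fderiv ℝ ρ x e :=
    ((hρ.continuous_fderiv one_ne_zero).clm_apply continuous_const).integrable_of_hasCompactSupport
      (hρc.fderiv_apply ℝ e)
  -- The sign of `h`, equal to `0` where `h` vanishes because `0⁻¹ = 0`. It is only measurable, but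
  -- `-(ψ ⋆ ρ)` is a `C¹` test function bounded by `1`.
  set ψ := fun x => h x * |h x|⁻¹ with hψ
  have hψm : Measurable ψ := hcont.measurable.mul hcont.abs.measurable.inv
  have hψc : HasCompactSupport ψ := hhc.mul_right
  have hψb : ∀ x, |ψ x| ≤ 1 := fun x => by
    simp only [hψ, abs_mul, abs_inv, abs_abs]
    exact mul_inv_le_one
  have hψh : ∀ x, ψ x * h x = |h x| := fun x => by
    rcases eq_or_ne (h x) 0 with h0 | h0
    · simp [hψ, h0]
    · simp only [hψ]
      rw [mul_right_comm, ← abs_mul_abs_self (h x), mul_assoc,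
        mul_inv_cancel₀ (abs_ne_zero.2 h0), mul_one]
  have hψi : Integrable ψ :=
    (integrable_indicator_iff hψc.isCompact.measurableSet).2
      (Measure.integrableOn_of_bounded (M := 1) hψc.isCompact.measure_lt_top.ne
        hψm.aestronglyMeasurable (.of_forall hψb)) |>.congr
      (.of_forall fun x => by rw [indicator_eq_self.2 (subset_tsupport ψ)])
  have hprod : Integrable (fun z : EuclideanSpace ℝ (Fin n) × EuclideanSpace ℝ (Fin n) =>
      ψ z.1 * (f z.2 * fderiv ℝ ρ (z.1 - z.2) e)) (volume.prod volume) :=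
    (hf.convolution_integrand (ContinuousLinearMap.lsmul ℝ ℝ) hρe).bdd_mul (c := 1)
      (hψm.comp measurable_fst).aestronglyMeasurable (.of_forall fun z => hψb _)
  have hΘ : ContDiff ℝ 1 (ψ ⋆ ρ) :=
    hρc.contDiff_convolution_right (n := 1) _ hψi.locallyIntegrable hρ
  calc ∫⁻ x, ‖h x‖ₑ = ENNReal.ofReal (∫ x, ψ x * h x) := by
        rw [← ofReal_integral_norm_eq_lintegral_enorm
          (hcont.integrable_of_hasCompactSupport hhc)]
        simp only [hψh, Real.norm_eq_abs]
    _ = ENNReal.ofReal (∫ t, f t * fderiv ℝ (fun x => -(ψ ⋆ ρ) x) t e) := by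
        congr 1
        -- Fubini moves the mollifier from `f` to `ψ`. Since `ρ` is even, its derivative is odd,
        -- which produces the minus sign.
        calc ∫ x, ψ x * h x = ∫ x, ∫ t, ψ x * (f t * fderiv ℝ ρ (x - t) e) := by
              simp only [integral_const_mul]
              refine integral_congr_ae (.of_forall fun x => ?_)
              simp only [hh, fderiv_convolution_apply hf.locallyIntegrable hρ hρc]
          _ = ∫ t, ∫ x, ψ x * (f t * fderiv ℝ ρ (x - t) e) := integral_integral_swap hprod
          _ = _ := by
              refine integral_congr_ae (.of_forall fun t => ?_)
              simp only [fderiv_fun_neg, neg_apply]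
              rw [fderiv_convolution_apply hψi.locallyIntegrable hρ hρc,
                ← integral_neg, ← integral_const_mul]
              refine integral_congr_ae (.of_forall fun x => ?_)
              simp only
              rw [← neg_sub t x, fderiv_neg_of_even he, neg_apply]
              ring
    _ ≤ variation f univ := by
        refine ofReal_integral_fderiv_le_variation f i hΘ.neg (hψc.convolution _ hρc).neg
          fun x => ?_
        rw [abs_neg]
        exact abs_convolution_le_one hψb
          (hρ.continuous.integrable_of_hasCompactSupport hρc) hρ0 hρ1 x

/-- Reduces the full gradient to partial derivatives, each bounded by the variation; this costs the
factor `n` in the Sobolev constant. -/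
lemma enorm_le_sum_apply_single {n : ℕ} (A : EuclideanSpace ℝ (Fin n) →L[ℝ] ℝ) :
    ‖A‖ₑ ≤ ∑ i, ‖A (EuclideanSpace.single i 1)‖ₑ := by
  have h : ‖A‖₊ ≤ ∑ i, ‖A (EuclideanSpace.single i 1)‖₊ := by
    refine A.opNNNorm_le_bound _ fun x => ?_
    have hx : A x = ∑ i, x i * A (EuclideanSpace.single i 1) := by
      conv_lhs => rw [← (EuclideanSpace.basisFun (Fin n) ℝ).sum_repr x]
      simp
    rw [hx, Finset.sum_mul]
    refine nnnorm_sum_le_of_le _ fun i _ => ?_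
    rw [nnnorm_mul, mul_comm]
    gcongr
    exact PiLp.nnnorm_apply_le x i
  simpa only [enorm_eq_nnnorm, ← ENNReal.ofNNReal_finsetSum, ENNReal.coe_le_coe] using h

lemma lintegral_enorm_convolution_le {n : ℕ} {f ρ : EuclideanSpace ℝ (Fin n) → ℝ}
    (hf : Integrable f) (hρ : Integrable ρ) (hρ0 : ∀ x, 0 ≤ ρ x) (hρ1 : ∫ x, ρ x = 1) :
    ∫⁻ x, ‖(f ⋆ ρ) x‖ₑ ≤ ∫⁻ x, ‖f x‖ₑ := by
  have hρ' : ∫⁻ x, ‖ρ x‖ₑ = 1 := by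
    rw [← ofReal_integral_norm_eq_lintegral_enorm hρ]
    simp [abs_of_nonneg (hρ0 _), hρ1]
  have hm := (hf.convolution_integrand (ContinuousLinearMap.lsmul ℝ ℝ) hρ).aestronglyMeasurable.enorm
  calc ∫⁻ x, ‖(f ⋆ ρ) x‖ₑ ≤ ∫⁻ x, ∫⁻ t, ‖f t • ρ (x - t)‖ₑ :=
        lintegral_mono fun x => enorm_integral_le_lintegral_enorm _
    _ = ∫⁻ t, ∫⁻ x, ‖f t • ρ (x - t)‖ₑ := lintegral_lintegral_swap hm
    _ = ∫⁻ t, ‖f t‖ₑ := by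
        refine lintegral_congr fun t => ?_
        simp only [enorm_smul]
        rw [lintegral_const_mul' _ _ enorm_ne_top,
          lintegral_sub_right_eq_self (fun x => ‖ρ x‖ₑ) t, hρ', mul_one]

/-- A multiplicative Sobolev inequality for functions of bounded variation. -/
theorem exists_lintegral_rpow_le_variation {n : ℕ} (hn : 1 ≤ n) :
    ∃ C : ℝ≥0, ∀ f : EuclideanSpace ℝ (Fin n) → ℝ, Integrable f → HasCompactSupport f →
      ∫⁻ x, ‖f x‖ₑ ^ (1 + 1 / (n : ℝ)) ≤
        C * (∫⁻ x, ‖f x‖ₑ) ^ (1 / (n : ℝ)) * variation f univ := by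
  obtain ⟨C, hC⟩ := exists_lintegral_rpow_le_lintegral_fderiv hn
  refine ⟨C * n, fun f hf hfc => ?_⟩
  -- The outer radius is always twice the inner one: almost everywhere convergence needs a bounded
  -- ratio (`K := 2` below).
  let φ : ℕ → ContDiffBump (0 : EuclideanSpace ℝ (Fin n)) := fun k =>
    ⟨1 / ((k : ℝ) + 1), 2 * (1 / ((k : ℝ) + 1)), by positivity, by
      have : (0 : ℝ) < 1 / ((k : ℝ) + 1) := by positivity
      linarith⟩
  set g := fun k => f ⋆ (φ k).normed volume with hg
  have hlim : ∀ᵐ x, Tendsto (fun k => g k x) atTop (𝓝 (f x)) := by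
    have h0 : Tendsto (fun k => (φ k).rOut) atTop (𝓝 0) := by
      simpa [φ] using (tendsto_one_div_add_atTop_nhds_zero_nat (𝕜 := ℝ)).const_mul 2
    filter_upwards [ContDiffBump.ae_convolution_tendsto_right_of_locallyIntegrable (K := 2) h0
      (.of_forall fun k => le_rfl) hf.locallyIntegrable] with x hx
    refine hx.congr fun k => ?_
    simp only [hg]
    rw [convolution_eq_swap, convolution_def]
    simp [mul_comm]
  have hsm : ∀ k, ContDiff ℝ 1 (g k) := fun k =>
    (φ k).hasCompactSupport_normed.contDiff_convolution_right (n := 1) _ hf.locallyIntegrable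
      (φ k).contDiff_normed
  have hgc : ∀ k, HasCompactSupport (g k) := fun k =>
    hfc.convolution _ (φ k).hasCompactSupport_normed
  have hbd : ∀ k, ∫⁻ x, ‖g k x‖ₑ ^ (1 + 1 / (n : ℝ)) ≤
      (C * n : ℝ≥0) * (∫⁻ x, ‖f x‖ₑ) ^ (1 / (n : ℝ)) * variation f univ := fun k => by
    have hd : ∫⁻ x, ‖fderiv ℝ (g k) x‖ₑ ≤ n * variation f univ := by
      have hm : ∀ i, Measurable fun x => ‖fderiv ℝ (g k) x (EuclideanSpace.single i 1)‖ₑ :=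
        fun i => (((hsm k).continuous_fderiv one_ne_zero).clm_apply
          continuous_const).enorm.measurable
      calc ∫⁻ x, ‖fderiv ℝ (g k) x‖ₑ
          ≤ ∫⁻ x, ∑ i, ‖fderiv ℝ (g k) x (EuclideanSpace.single i 1)‖ₑ :=
            lintegral_mono fun x => enorm_le_sum_apply_single _
        _ = ∑ i, ∫⁻ x, ‖fderiv ℝ (g k) x (EuclideanSpace.single i 1)‖ₑ :=
            lintegral_finsetSum _ fun i _ => hm i
        _ ≤ ∑ _i : Fin n, variation f univ := Finset.sum_le_sum fun i _ =>
            lintegral_fderiv_convolution_le_variation hf hfc (φ k).contDiff_normed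
              (φ k).hasCompactSupport_normed (φ k).normed_neg (φ k).nonneg_normed
              (φ k).integral_normed i
        _ = n * variation f univ := by simp
    calc _ ≤ C * (∫⁻ x, ‖g k x‖ₑ) ^ (1 / (n : ℝ)) * ∫⁻ x, ‖fderiv ℝ (g k) x‖ₑ :=
          hC _ (hsm k) (hgc k)
      _ ≤ C * (∫⁻ x, ‖f x‖ₑ) ^ (1 / (n : ℝ)) * (n * variation f univ) := by
          refine mul_le_mul' (mul_le_mul_right (ENNReal.rpow_le_rpow ?_ (by positivity)) _) hd
          exact lintegral_enorm_convolution_le hf (φ k).integrable_normed (φ k).nonneg_normed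
            (φ k).integral_normed
      _ = _ := by push_cast; ring
  -- Fatou's lemma along the mollifications, whose bound does not depend on `k`.
  calc ∫⁻ x, ‖f x‖ₑ ^ (1 + 1 / (n : ℝ))
      = ∫⁻ x, liminf (fun k => ‖g k x‖ₑ ^ (1 + 1 / (n : ℝ))) atTop := by
        refine lintegral_congr_ae ?_
        filter_upwards [hlim] with x hx
        exact (((ENNReal.continuous_rpow_const.tendsto _).comp hx.enorm).liminf_eq).symm
    _ ≤ liminf (fun k => ∫⁻ x, ‖g k x‖ₑ ^ (1 + 1 / (n : ℝ))) atTop :=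
        lintegral_liminf_le fun k => (hsm k).continuous.enorm.measurable.pow_const _
    _ ≤ liminf (fun _ : ℕ => _) atTop := liminf_le_liminf (.of_forall hbd)
    _ = _ := liminf_const _

/-! ### Sign and power inequalities -/

lemma mul_eq_abs_of_mem_Sgn {s t : ℝ} (h : s ∈ Sgn t) : s * t = |t| := by
  unfold Sgn at h
  split_ifs at h with h1 h2
  · rw [mem_singleton_iff.1 h, abs_of_pos h1, one_mul]
  · rw [mem_singleton_iff.1 h, abs_of_neg h2, neg_one_mul]
  · have : t = 0 := le_antisymm (not_lt.1 h1) (not_lt.1 h2)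
    simp [this]

/-- A pointwise substitute for interpolation between `L¹` and `L^m`: the exponent `1` dominates for
`t ≤ 1`, the exponent `m` for `t ≥ 1`. -/
lemma rpow_le_add_rpow {t r m : ℝ} (ht : 0 ≤ t) (hr : 1 ≤ r) (hrm : r ≤ m) :
    t ^ r ≤ t + t ^ m := by
  rcases le_total t 1 with h | h
  · have h1 : t ^ r ≤ t ^ (1 : ℝ) := Real.rpow_le_rpow_of_exponent_ge_of_imp ht h hr (by
      intro _ h0; linarith)
    rw [Real.rpow_one] at h1
    have := Real.rpow_nonneg ht m
    linarith
  · have := Real.rpow_le_rpow_of_exponent_le h hrm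
    linarith

/-! ### Finite energy and zero extension -/

section energy

variable {n : ℕ} {Ω : Set (EuclideanSpace ℝ (Fin n))} {f : EuclideanSpace ℝ (Fin n) → ℝ}

lemma bvNorm_lt_top_of_energyTV_ne_top (h : energyTV Ω f ≠ ∞) : bvNorm Ω f < ∞ := by
  by_contra h'
  simp [energyTV, h'] at h

lemma energyTV_eq_variation (h : energyTV Ω f ≠ ∞) :
    energyTV Ω f = variation (Ω.indicator f) univ := by
  simp [energyTV, bvNorm_lt_top_of_energyTV_ne_top h]

/-- Fields supported in `Ω` also compete in the supremum over the whole space. Equality is only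
almost everywhere because the rescaled function is an `L^p` class. -/
lemma variation_const_smul_le_energyTV (hΩ : MeasurableSet Ω) (h : energyTV Ω f ≠ ∞) {a : ℝ}
    (ha : 0 ≤ a) {g : EuclideanSpace ℝ (Fin n) → ℝ} (hg : g =ᵐ[volume.restrict Ω] a • f) :
    variation g Ω ≤ ENNReal.ofReal a * energyTV Ω f := by
  rw [energyTV_eq_variation h]
  refine iSup₂_le fun φ hφ => ?_
  have : ∫ x in Ω, g x * divergence φ x =
      a * ∫ x in univ, Ω.indicator f x * divergence φ x := by
    rw [setIntegral_univ, ← integral_const_mul, ← integral_indicator hΩ]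
    have h1 : ∫ x in Ω, g x * divergence φ x = ∫ x in Ω, a * (f x * divergence φ x) := by
      refine integral_congr_ae ?_
      filter_upwards [hg] with x hx
      rw [hx, Pi.smul_apply, smul_eq_mul, mul_assoc]
    rw [integral_indicator hΩ, h1, ← integral_indicator hΩ]
    refine integral_congr_ae (.of_forall fun x => ?_)
    by_cases hx : x ∈ Ω <;> simp [hx]
  rw [this, ENNReal.ofReal_mul ha]
  gcongr
  exact le_iSup₂_of_le (f := fun φ _ => ENNReal.ofReal
    (∫ x in univ, Ω.indicator f x * divergence φ x)) φ
    ⟨hφ.1, hφ.2.1, subset_univ _, hφ.2.2.2⟩ le_rfl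

end energy

/-! ### Estimates in `L^p(Ω)` -/

section Lp

variable {n : ℕ} {Ω : Set (EuclideanSpace ℝ (Fin n))} {p q : ℝ≥0∞}

/-- No summand is `⊥`, so a single infinite summand makes the sum `⊤`. -/
lemma finite_of_constrainedEnergy_ne_top {EPer : LpOn Ω p → ℝ} {α : ℝ} {v : LpOn Ω p}
    (h : constrainedEnergy EPer α v ≠ ⊤) : energyTV Ω v ≠ ∞ ∧ constraintG v = α := by
  constructor
  · intro h'
    apply h
    unfold constrainedEnergy
    rw [h']
    split_ifs <;> simp
  · by_contra h'
    apply h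
    unfold constrainedEnergy
    rw [if_neg h']
    refine EReal.add_top_of_ne_bot ?_
    simp

lemma integrable_of_energyTV_ne_top {v : LpOn Ω p} (h : energyTV Ω v ≠ ∞) :
    Integrable v (volume.restrict Ω) := by
  rw [← memLp_one_iff_integrable]
  exact ⟨Lp.aestronglyMeasurable v,
    lt_of_le_of_lt le_self_add (bvNorm_lt_top_of_energyTV_ne_top h)⟩

lemma lintegral_enorm_eq_constraintG {v : LpOn Ω p} (h : energyTV Ω v ≠ ∞) :
    ∫⁻ x in Ω, ‖v x‖ₑ = ENNReal.ofReal (constraintG v) := by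
  rw [← ofReal_integral_norm_eq_lintegral_enorm (integrable_of_energyTV_ne_top h)]
  rfl

variable [ENNReal.HolderConjugate q p]

lemma integrable_mul_Lp (w : LpOn Ω q) (v : LpOn Ω p) :
    Integrable (fun x => w x * v x) (volume.restrict Ω) :=
  (Lp.memLp w).integrable_mul (Lp.memLp v)

lemma abs_integral_mul_le_norm (w : LpOn Ω q) (v : LpOn Ω p) :
    |∫ x in Ω, w x * v x| ≤ ‖w‖ * ‖v‖ := by
  have h : eLpNorm (⇑w • ⇑v) 1 (volume.restrict Ω) ≤
      eLpNorm w q (volume.restrict Ω) * eLpNorm v p (volume.restrict Ω) :=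
    eLpNorm_smul_le_mul_eLpNorm (Lp.aestronglyMeasurable v) (Lp.aestronglyMeasurable w)
  rw [eLpNorm_one_eq_lintegral_enorm] at h
  calc |∫ x in Ω, w x * v x| ≤ (∫⁻ x in Ω, ‖w x * v x‖ₑ).toReal := by
        rw [← Real.norm_eq_abs, ← toReal_enorm]
        refine ENNReal.toReal_mono ?_ (enorm_integral_le_lintegral_enorm _)
        exact (integrable_mul_Lp w v).2.ne
    _ ≤ _ := by
        rw [Lp.norm_def, Lp.norm_def, ← ENNReal.toReal_mul]
        exact ENNReal.toReal_mono (ENNReal.mul_ne_top (Lp.eLpNorm_ne_top w)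
          (Lp.eLpNorm_ne_top v)) h

lemma bvNorm_const_smul_le (hΩ : MeasurableSet Ω) {v : LpOn Ω p} (h : energyTV Ω v ≠ ∞) {a : ℝ}
    (ha : 0 ≤ a) :
    bvNorm Ω (a • v : LpOn Ω p) ≤
      ENNReal.ofReal (a * (constraintG v + (energyTV Ω v).toReal)) := by
  have hG : 0 ≤ constraintG v := integral_nonneg fun _ => abs_nonneg _
  have hae : ⇑(a • v : LpOn Ω p) =ᵐ[volume.restrict Ω] a • ⇑v := Lp.coeFn_smul a v
  have h1 : eLpNorm (a • v : LpOn Ω p) 1 (volume.restrict Ω) =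
      ENNReal.ofReal a * ENNReal.ofReal (constraintG v) := by
    rw [eLpNorm_congr_ae hae, eLpNorm_const_smul, eLpNorm_one_eq_lintegral_enorm,
      lintegral_enorm_eq_constraintG h, Real.enorm_eq_ofReal ha]
  have h2 := variation_const_smul_le_energyTV hΩ h ha hae
  rw [ENNReal.ofReal_mul ha, ENNReal.ofReal_add hG ENNReal.toReal_nonneg,
    ENNReal.ofReal_toReal h, mul_add]
  exact add_le_add h1.le h2

variable [Fact (1 ≤ p)] [Fact (1 ≤ q)]

/-- The bound of the `L^p` norm by the `L¹` norm and the total variation. -/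
lemma exists_norm_rpow_le (hn : 1 ≤ n) (hΩo : MeasurableSet Ω) (hΩb : Bornology.IsBounded Ω)
    (hp2 : p ≤ 1 + 1 / (n : ℝ≥0∞)) :
    ∃ C : ℝ≥0, ∀ v : LpOn Ω p, energyTV Ω v ≠ ∞ → 0 < constraintG v →
      ‖v‖ ^ p.toReal ≤ constraintG v ^ p.toReal *
        (1 + C * ((constraintG v)⁻¹ * (energyTV Ω v).toReal)) := by
  obtain ⟨C, hC⟩ := exists_lintegral_rpow_le_variation hn
  refine ⟨C, fun v hv hα => ?_⟩
  set α := constraintG v with hαd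
  set E := (energyTV Ω v).toReal with hE
  set r := p.toReal with hr
  have hn0 : (0 : ℝ) < n := by exact_mod_cast hn
  have hn0' : (n : ℝ≥0∞) ≠ 0 := by exact_mod_cast (by omega : n ≠ 0)
  set m := 1 + 1 / (n : ℝ) with hm
  have htop : 1 + 1 / (n : ℝ≥0∞) ≠ ∞ := by simp; omega
  have hp0 : p ≠ 0 := (zero_lt_one.trans_le Fact.out).ne'
  have hpt : p ≠ ∞ := ne_top_of_le_ne_top htop hp2
  have hr1 : 1 ≤ r := by
    have := ENNReal.toReal_mono hpt (Fact.out : 1 ≤ p)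
    simpa using this
  have hrm : r ≤ m := by
    have := ENNReal.toReal_mono htop hp2
    rwa [ENNReal.toReal_add (by simp) (by simp; omega), ENNReal.toReal_div] at this
  have hint := integrable_of_energyTV_ne_top hv
  have hL1 := lintegral_enorm_eq_constraintG hv
  have hind : ∀ s : ℝ, 0 < s →
      ∫⁻ x, ‖Ω.indicator v x‖ₑ ^ s = ∫⁻ x in Ω, ‖v x‖ₑ ^ s := fun s hs => by
    rw [← lintegral_indicator hΩo]
    refine lintegral_congr fun x => ?_
    by_cases hx : x ∈ Ω <;> simp [hx, hs]
  have hS := hC (Ω.indicator v) ((integrable_indicator_iff hΩo).2 hint)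
    (HasCompactSupport.of_support_subset_isCompact hΩb.isCompact_closure
      ((support_indicator_subset).trans subset_closure))
  have h1 := hind 1 one_pos
  simp only [ENNReal.rpow_one] at h1
  rw [hind m (by positivity), h1, hL1, ← energyTV_eq_variation hv,
    ← ENNReal.ofReal_toReal hv, ENNReal.ofReal_rpow_of_nonneg hα.le (by positivity),
    ← ENNReal.ofReal_coe_nnreal, ← ENNReal.ofReal_mul (by positivity),
    ← ENNReal.ofReal_mul (by positivity)] at hS
  have hmeas : AEMeasurable (fun x => ‖v x‖ₑ) (volume.restrict Ω) :=
    (Lp.aestronglyMeasurable v).enorm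
  -- `rpow_le_add_rpow` at `|t| / α`, multiplied by `α ^ r`; dividing by `α` normalizes the mass to
  -- `1`.
  have hpt1 : ∀ t : ℝ, ‖t‖ₑ ^ r ≤ ENNReal.ofReal (α ^ r * α⁻¹) * ‖t‖ₑ +
      ENNReal.ofReal (α ^ r * (α ^ m)⁻¹) * ‖t‖ₑ ^ m := fun t => by
    have h := rpow_le_add_rpow (t := |t| / α) (by positivity) hr1 hrm
    rw [Real.div_rpow (abs_nonneg _) hα.le, Real.div_rpow (abs_nonneg _) hα.le,
      div_le_iff₀ (by positivity)] at h
    rw [Real.enorm_eq_ofReal_abs, ENNReal.ofReal_rpow_of_nonneg (abs_nonneg _) (by positivity),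
      ENNReal.ofReal_rpow_of_nonneg (abs_nonneg _) (by positivity),
      ← ENNReal.ofReal_mul (by positivity), ← ENNReal.ofReal_mul (by positivity),
      ← ENNReal.ofReal_add (by positivity) (by positivity)]
    refine ENNReal.ofReal_le_ofReal (h.trans_eq ?_)
    rw [div_eq_mul_inv, div_eq_mul_inv]
    ring
  have hmain : ∫⁻ x in Ω, ‖v x‖ₑ ^ r ≤ ENNReal.ofReal (α ^ r * (1 + C * (α⁻¹ * E))) := by
    calc ∫⁻ x in Ω, ‖v x‖ₑ ^ r
        ≤ ∫⁻ x in Ω, (ENNReal.ofReal (α ^ r * α⁻¹) * ‖v x‖ₑ +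
            ENNReal.ofReal (α ^ r * (α ^ m)⁻¹) * ‖v x‖ₑ ^ m) := lintegral_mono fun x => hpt1 _
      _ = ENNReal.ofReal (α ^ r * α⁻¹) * ENNReal.ofReal α +
            ENNReal.ofReal (α ^ r * (α ^ m)⁻¹) * ∫⁻ x in Ω, ‖v x‖ₑ ^ m := by
          rw [lintegral_add_left' (hmeas.const_mul _), lintegral_const_mul'' _ hmeas,
            lintegral_const_mul'' _ (hmeas.pow_const _), hL1]
      _ ≤ ENNReal.ofReal (α ^ r * α⁻¹) * ENNReal.ofReal α +
            ENNReal.ofReal (α ^ r * (α ^ m)⁻¹) * ENNReal.ofReal (C * α ^ (1 / (n : ℝ)) * E) := by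
          gcongr
      _ = _ := by
          rw [← ENNReal.ofReal_mul (by positivity), ← ENNReal.ofReal_mul (by positivity),
            ← ENNReal.ofReal_add (by positivity) (by positivity)]
          congr 1
          -- As `α^m = α · α^(1/n)`, the Sobolev factor `α^(1/n)` cancels and only `α⁻¹ E` remains.
          rw [hm, Real.rpow_add hα, Real.rpow_one]
          have : α ^ (1 / (n : ℝ)) ≠ 0 := by positivity
          field_simp
  have hnorm : ‖v‖ ^ r = (∫⁻ x in Ω, ‖v x‖ₑ ^ r).toReal := by
    rw [Lp.norm_def, eLpNorm_eq_lintegral_rpow_enorm_toReal hp0 hpt, ENNReal.toReal_rpow,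
      ← ENNReal.rpow_mul, one_div_mul_cancel (by positivity), ENNReal.rpow_one]
  rw [hnorm]
  exact ENNReal.toReal_le_of_le_ofReal (by positivity) hmain

/-- Testing the Euler-Lagrange equation with the eigenfunction itself. -/
lemma exists_mul_constraintG_eq {EPer : LpOn Ω p → ℝ} {v : LpOn Ω p} {l : ℝ}
    (h : IsEigenvalue q EPer v l) :
    ∃ w : LpOn Ω q, InGradient EPer v w ∧
      l * constraintG v = (energyTV Ω v).toReal + ∫ x in Ω, w x * v x := by
  obtain ⟨s, z, d, w, -, hs, -, -, -, hE, hw, heq⟩ := h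
  refine ⟨w, hw, ?_⟩
  have hE' : (energyTV Ω v).toReal = -∫ x in Ω, d x * v x := by
    rw [← EReal.toReal_coe_ennreal, hE, EReal.toReal_coe]
    simp only [mul_comm]
  rw [hE', neg_add_eq_sub, ← integral_sub (integrable_mul_Lp w v) (integrable_mul_Lp d v),
    constraintG, ← integral_const_mul]
  refine integral_congr_ae ?_
  filter_upwards [hs, heq] with x h1 h2
  -- `s v = |v|` turns the right side of the equation, multiplied by `v`, into the constraint
  -- density.
  rw [← mul_eq_abs_of_mem_Sgn h1, ← mul_assoc, ← h2]
  ring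

end Lp

/-- The quotient of total variation and constraint is bounded for small `α`, and the eigenvalue and
the rescaled critical value differ by `O(α^(r-1))`. -/
lemma exists_bound_and_tendsto_of_growth {r K L B α₀ : ℝ} (hr : 1 < r) (hK : 0 ≤ K) (hL : 0 ≤ L)
    (hα₀ : 0 < α₀) {T P Q c l : ℝ → ℝ} (hT0 : ∀ α ∈ Ioc 0 α₀, 0 ≤ T α)
    (hc : ∀ α ∈ Ioc 0 α₀, c α = T α + α⁻¹ * P α) (hcB : ∀ α ∈ Ioc 0 α₀, |c α| ≤ B)
    (hl : ∀ α ∈ Ioc 0 α₀, l α = T α + α⁻¹ * Q α)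
    (hP : ∀ α ∈ Ioc 0 α₀, |P α| ≤ K * (α ^ r * (1 + L * T α)))
    (hQ : ∀ α ∈ Ioc 0 α₀, |Q α| ≤ r * K * (α ^ r * (1 + L * T α))) :
    (∃ α₁ ∈ Ioc 0 α₀, ∃ M : ℝ, ∀ α ∈ Ioc 0 α₁, T α ≤ M) ∧
      Tendsto (fun α => c α - l α) (𝓝[>] 0) (𝓝 0) := by
  have hpow : Tendsto (fun α : ℝ => α ^ (r - 1)) (𝓝[>] 0) (𝓝 0) := by
    have := (Real.continuousAt_rpow_const 0 (r - 1) (Or.inr (by linarith))).tendsto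
    rw [Real.zero_rpow (by linarith)] at this
    exact this.mono_left nhdsWithin_le_nhds
  have hscale : ∀ α, 0 < α → ∀ R S N : ℝ, |R| ≤ N * (α ^ r * S) →
      |α⁻¹ * R| ≤ N * (α ^ (r - 1) * S) := fun α hα R S N h => by
    rw [abs_mul, abs_of_pos (inv_pos.2 hα), Real.rpow_sub_one hα.ne']
    calc α⁻¹ * |R| ≤ α⁻¹ * (N * (α ^ r * S)) := by gcongr
      _ = _ := by ring
  -- These thresholds give `T ≤ B + 1 + T / 2`, hence `T ≤ 2 (B + 1)`.
  have hsmall : ∀ᶠ α in 𝓝[>] (0 : ℝ), K * α ^ (r - 1) < 1 ∧ K * L * α ^ (r - 1) < 1 / 2 := by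
    have h1 := hpow.const_mul K
    have h2 := hpow.const_mul (K * L)
    rw [mul_zero] at h1 h2
    exact (h1.eventually_lt_const one_pos).and (h2.eventually_lt_const one_half_pos)
  obtain ⟨ε, hε, hεs⟩ := (mem_nhdsGT_iff_exists_Ioc_subset).1 hsmall
  have hbound : ∀ α ∈ Ioc 0 (min ε α₀), T α ≤ 2 * (B + 1) := fun α hα => by
    have hα' : α ∈ Ioc 0 α₀ := ⟨hα.1, hα.2.trans (min_le_right _ _)⟩
    obtain ⟨h1, h2⟩ := hεs ⟨hα.1, hα.2.trans (min_le_left _ _)⟩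
    have h3 := (abs_le.1 (hscale α hα.1 _ _ _ (hP α hα'))).1
    have h4 := (abs_le.1 (hcB α hα')).2
    rw [hc α hα'] at h4
    have h5 := mul_le_mul_of_nonneg_right h2.le (hT0 α hα')
    nlinarith
  have hmin : (0 : ℝ) < min ε α₀ := lt_min hε hα₀
  refine ⟨⟨min ε α₀, ⟨hmin, min_le_right _ _⟩, _, hbound⟩, ?_⟩
  have hlim : Tendsto (fun α : ℝ => (1 + r) * K * (1 + L * (2 * (B + 1))) * α ^ (r - 1))
      (𝓝[>] 0) (𝓝 0) := by
    simpa using hpow.const_mul ((1 + r) * K * (1 + L * (2 * (B + 1))))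
  refine squeeze_zero_norm' ?_ hlim
  filter_upwards [Ioc_mem_nhdsGT hmin] with α hα
  have hα' : α ∈ Ioc 0 α₀ := ⟨hα.1, hα.2.trans (min_le_right _ _)⟩
  have h1 := hscale α hα.1 _ _ _ (hP α hα')
  have h2 := hscale α hα.1 _ _ _ (hQ α hα')
  have hα0 : 0 < α := hα.1
  rw [hc α hα', hl α hα', Real.norm_eq_abs, add_sub_add_left_eq_sub]
  calc |α⁻¹ * P α - α⁻¹ * Q α| ≤ |α⁻¹ * P α| + |α⁻¹ * Q α| := abs_sub _ _
    _ ≤ K * (α ^ (r - 1) * (1 + L * T α)) + r * K * (α ^ (r - 1) * (1 + L * T α)) :=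
        add_le_add h1 h2
    _ = (1 + r) * K * (1 + L * T α) * α ^ (r - 1) := by ring
    _ ≤ _ := by
        gcongr
        exact hbound α hα

end PerturbedOneLaplace

/-! ### The eigenvalue problem for small `α` -/

theorem proposition5p1
    (n : ℕ) (hn : 1 ≤ n)
    (Ω : Set (EuclideanSpace ℝ (Fin n)))
    (hΩo : IsOpen Ω) (hΩb : Bornology.IsBounded Ω)
    (hΩL : PerturbedOneLaplace.HasLipschitzBoundary Ω)
    (p q : ℝ≥0∞) [Fact (1 ≤ p)] [Fact (1 ≤ q)] [ENNReal.HolderConjugate q p]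
    (hp1 : 1 < p) (hp2 : p ≤ 1 + 1 / (n : ℝ≥0∞))
    (EPer : PerturbedOneLaplace.LpOn Ω p → ℝ)
    (hE : PerturbedOneLaplace.IsAdmissiblePerturbation q EPer)
    (α₀ : ℝ) (hα₀ : 0 < α₀)
    (u : ℝ → PerturbedOneLaplace.LpOn Ω p) (lam : ℝ → ℝ)
    (hcrit : ∀ α ∈ Ioc 0 α₀,
      PerturbedOneLaplace.IsCriticalPoint
        (PerturbedOneLaplace.constrainedEnergy EPer α) (u α))
    (hlam : ∀ α ∈ Ioc 0 α₀, PerturbedOneLaplace.IsEigenvalue q EPer (u α) (lam α))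
    (c : ℝ → ℝ)
    (hc : ∀ α, c α = α⁻¹ * PerturbedOneLaplace.energyValue EPer (u α))
    (hcb : ∃ B : ℝ, ∀ α ∈ Ioc 0 α₀, |c α| ≤ B) :
    (∃ α₁ ∈ Ioc 0 α₀, ∃ R : ℝ≥0, ∀ α ∈ Ioc 0 α₁,
      PerturbedOneLaplace.bvNorm Ω (α⁻¹ • u α : PerturbedOneLaplace.LpOn Ω p) ≤ R) ∧
    ((∃ l : ℝ, Tendsto c (𝓝[>] 0) (𝓝 l)) ↔ (∃ l : ℝ, Tendsto lam (𝓝[>] 0) (𝓝 l))) ∧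
    (∀ l m : ℝ, Tendsto c (𝓝[>] 0) (𝓝 l) → Tendsto lam (𝓝[>] 0) (𝓝 m) → m = l) := by

  open PerturbedOneLaplace in
  obtain ⟨-, -, K, hK, hP, hgrad⟩ := hE
  obtain ⟨L, hL⟩ := exists_norm_rpow_le hn hΩo.measurableSet hΩb hp2
  obtain ⟨B, hB⟩ := hcb
  have hpt : p ≠ ∞ := ne_top_of_le_ne_top (by simp; omega) hp2
  have hr : 1 < p.toReal := by simpa using (ENNReal.toReal_lt_toReal ENNReal.one_ne_top hpt).2 hp1
  have hfin : ∀ α ∈ Ioc 0 α₀, energyTV Ω (u α) ≠ ∞ ∧ constraintG (u α) = α := fun α hα =>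
    finite_of_constrainedEnergy_ne_top (hcrit α hα).choose
  have hnorm : ∀ α ∈ Ioc 0 α₀, ‖u α‖ ^ p.toReal ≤
      α ^ p.toReal * (1 + L * (α⁻¹ * (energyTV Ω (u α)).toReal)) := fun α hα => by
    obtain ⟨h1, h2⟩ := hfin α hα
    have := hL (u α) h1 (by rw [h2]; exact hα.1)
    rwa [h2] at this
  -- `Q` is `∫ u* u_α`; the value `0` outside the interval makes it a total function of `α`.
  have hex : ∀ α, ∃ Q : ℝ, α ∈ Ioc 0 α₀ →
      lam α * α = (energyTV Ω (u α)).toReal + Q ∧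
        |Q| ≤ p.toReal * K * ‖u α‖ ^ p.toReal := fun α => by
    by_cases hα : α ∈ Ioc 0 α₀
    · obtain ⟨w, hw, h⟩ := exists_mul_constraintG_eq (hlam α hα)
      rw [(hfin α hα).2] at h
      refine ⟨_, fun _ => ⟨h, (abs_integral_mul_le_norm w (u α)).trans ?_⟩⟩
      calc ‖w‖ * ‖u α‖ ≤ p.toReal * K * ‖u α‖ ^ (p.toReal - 1) * ‖u α‖ := by
            gcongr
            exact hgrad _ _ hw
        _ = p.toReal * K * ‖u α‖ ^ p.toReal := by
            rw [mul_assoc]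
            congr 1
            conv_lhs => rw [← Real.rpow_one ‖u α‖, ← Real.rpow_mul (norm_nonneg _), one_mul]
            rw [← Real.rpow_add_of_nonneg (norm_nonneg _) (by linarith) zero_le_one,
              sub_add_cancel]
    · exact ⟨0, fun h => absurd h hα⟩
  choose Q hQ using hex
  obtain ⟨⟨α₁, hα₁, M, hM⟩, hlim⟩ := exists_bound_and_tendsto_of_growth (L := L) hr hK.le
    L.coe_nonneg hα₀ (T := fun α => α⁻¹ * (energyTV Ω (u α)).toReal) (P := fun α => EPer (u α))
    (Q := Q) (c := c) (l := lam)
    (fun α hα => mul_nonneg (inv_nonneg.2 hα.1.le) ENNReal.toReal_nonneg)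
    (fun α hα => by rw [hc, energyValue, mul_add]) hB
    (fun α hα => by
      rw [← mul_add, ← (hQ α hα).1]
      field_simp [hα.1.ne'])
    (fun α hα => (hP _).trans (mul_le_mul_of_nonneg_left (hnorm α hα) hK.le))
    (fun α hα => (hQ α hα).2.trans
      (mul_le_mul_of_nonneg_left (hnorm α hα) (by positivity)))
  -- In `1 + M`, the `1` is the mass of `u_α/α` and `M` bounds its variation.
  refine ⟨⟨α₁, hα₁, (1 + M).toNNReal, fun α hα => ?_⟩, ⟨?_, ?_⟩, ?_⟩
  · have hα' : α ∈ Ioc 0 α₀ := ⟨hα.1, hα.2.trans hα₁.2⟩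
    refine (bvNorm_const_smul_le hΩo.measurableSet (hfin α hα').1 (inv_nonneg.2 hα.1.le)).trans ?_
    rw [(hfin α hα').2, mul_add, inv_mul_cancel₀ hα.1.ne']
    exact ENNReal.ofReal_le_ofReal (by linarith [hM α hα])
  · rintro ⟨l, hl⟩
    exact ⟨l, by simpa using hl.sub hlim⟩
  · rintro ⟨l, hl⟩
    exact ⟨l, by simpa using hl.add hlim⟩
  · intro l m hl hm
    have h := tendsto_nhds_unique hlim (hl.sub hm)
    linarith
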